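/- Let $p$ be a prime and let $K\subset L$ be a Galois extension of number fields of degree $p$, with Galois group $C_p=\mathrm{Gal}(L/K)$. Let $\pi_\sharp\colon Cl(K)\to Cl(L)$ be the capitulation map, $[I]\mapsto[I\,\mathcal O_L]$. Let $U_L$ be the group of idelic units of $L$, i.e. the ideles $(x_\nu)$ of $L$ such that $x_\nu$ has valuation $0$ at every finite place $\nu$ (equivalently, the kernel of the natural map from the ideles of $L$ to the fractional ideals of $L$), with its natural action of $C_p$; the group $\mathcal O_L^*$ embeds diagonally in $U_L$. Then there is a canonical isomorphism of groups $$\mathrm{Ker}\bigl(\pi_\sharp\colon Cl(K)\to Cl(L)\bigr)\;\cong\;\mathrm{Ker}\bigl(H^1(C_p,\mathcal O_L^*)\to H^1(C_p,U_L)\bigr),$$ where the map on cohomology is induced by $\mathcal O_L^*\hookrightarrow U_L$. Explicitly, if $I$ is a nonzero ideal of $\mathcal O_K$ with $I\,\mathcal O_L=(a)$, $a\in\mathcal O_L$, then the class of $I$ corresponds to the class of the cocycle $\sigma\mapsto a/\sigma(a)$. -/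

import Mathlib

open NumberField IsDedekindDomain
open scoped NumberField.AdeleRing nonZeroDivisors RestrictedProduct

noncomputable section

namespace IdelicUnits

/-! ### Maps between completions induced by a field endomorphism -/

section Infinite

variable {L : Type*} [Field L]

lemma isometry_infinite (f : L →+* L) {v w : InfinitePlace L} (h : ∀ a, w (f a) = v a) :
    Isometry (WithAbs.map v.1 w.1 f) :=
  AddMonoidHomClass.isometry_of_norm _ fun x ↦ h x.ofAbs

/-- If `|f a|_w = |a|_v` for all `a : L`, the continuous extension `L_v → L_w` of `f`. -/
def infiniteMap (f : L →+* L) {v w : InfinitePlace L} (h : ∀ a, w (f a) = v a) :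
    v.Completion →+* w.Completion :=
  ((InfinitePlace.Completion.equiv w).symm.toRingHom.comp
    (isometry_infinite f h).mapRingHom).comp (InfinitePlace.Completion.equiv v).toRingHom

lemma infiniteMap_coe (f : L →+* L) {v w : InfinitePlace L} (h : ∀ a, w (f a) = v a) (a : L) :
    infiniteMap f h (a : v.Completion) = ((f a : L) : w.Completion) :=
  InfinitePlace.Completion.ext <| (isometry_infinite f h).mapRingHom_coe (WithAbs.toAbs v.1 a)

lemma continuous_infiniteMap (f : L →+* L) {v w : InfinitePlace L} (h : ∀ a, w (f a) = v a) :
    Continuous (infiniteMap f h) :=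
  (InfinitePlace.Completion.continuous_ofCompletion w).comp <|
    UniformSpace.Completion.continuous_map.comp
      (InfinitePlace.Completion.continuous_toCompletion v)

lemma infiniteMap_id {v : InfinitePlace L} (f : L →+* L) (hf : ∀ a, f a = a)
    (h : ∀ a, v (f a) = v a) (x : v.Completion) : infiniteMap f h x = x := by
  induction x using InfinitePlace.Completion.induction_on with
  | hp => exact isClosed_eq (continuous_infiniteMap f h) continuous_id
  | ih a => exact (infiniteMap_coe f h a.ofAbs).trans (by rw [hf])

lemma infiniteMap_comp {u v w : InfinitePlace L} (f g k : L →+* L) (hk : ∀ a, k a = f (g a))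
    (hf : ∀ a, w (f a) = v a) (hg : ∀ a, v (g a) = u a) (hfg : ∀ a, w (k a) = u a)
    (x : u.Completion) : infiniteMap k hfg x = infiniteMap f hf (infiniteMap g hg x) := by
  induction x using InfinitePlace.Completion.induction_on with
  | hp => exact isClosed_eq (continuous_infiniteMap k hfg) <|
        ((continuous_infiniteMap f hf).comp (continuous_infiniteMap g hg))
  | ih a =>
    refine (infiniteMap_coe k hfg a.ofAbs).trans ?_
    rw [hk]
    exact ((congrArg _ (infiniteMap_coe g hg a.ofAbs)).trans (infiniteMap_coe f hf _)).symm

end Infinite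

section Finite

variable {R L : Type*} [CommRing R] [IsDedekindDomain R] [Field L] [Algebra R L]
  [IsFractionRing R L]

lemma continuous_finite (f : L ≃+* L) {v w : HeightOneSpectrum R}
    (h : ∀ a, w.valuation L (f a) = v.valuation L a) :
    Continuous (WithVal.map (v.valuation L) (w.valuation L) (f : L →+* L)) := by
  refine continuous_of_continuousAt_zero _ ?_
  simp_rw [ContinuousAt, map_zero, (Valued.hasBasis_nhds_zero _ _).tendsto_iff
    (Valued.hasBasis_nhds_zero _ _), true_and, forall_const]
  intro γ
  obtain ⟨r, s, hr₀, hs₀, hr⟩ := Valuation.exists_div_eq_of_unit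
    (Valued.v : Valuation (WithVal (w.valuation L)) _) γ
  have key : ∀ a : WithVal (w.valuation L), Valued.v a =
      Valued.v (WithVal.toVal (v.valuation L) (f.symm a.ofVal)) := fun a ↦ by
    have := h (f.symm a.ofVal)
    rw [f.apply_symm_apply] at this
    exact this
  have key' : ∀ a : WithVal (v.valuation L),
      Valued.v (WithVal.map (v.valuation L) (w.valuation L) (f : L →+* L) a) = Valued.v a :=
    fun a ↦ h a.ofVal
  set r' := WithVal.toVal (v.valuation L) (f.symm r.ofVal)
  set s' := WithVal.toVal (v.valuation L) (f.symm s.ofVal)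
  rw [key] at hr₀ hs₀
  have hr' : 0 < Valued.v.restrict r' := Valuation.restrict_pos_iff _ _ |>.2 hr₀
  have hs' : 0 < Valued.v.restrict s' := Valuation.restrict_pos_iff _ _ |>.2 hs₀
  have hs'' : 0 < Valued.v.restrict s :=
    Valuation.restrict_pos_iff _ _ |>.2 (by rw [key]; exact hs₀)
  refine ⟨Units.mk0 (Valued.v.restrict r' / Valued.v.restrict s')
    (div_pos hr' hs').ne', fun x hx ↦ ?_⟩
  simp only [Set.mem_ofPred_eq, Units.val_mk0, ← hr] at hx ⊢
  rw [lt_div_iff₀ hs', ← map_mul, Valuation.restrict_lt_iff, map_mul] at hx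
  rw [lt_div_iff₀ hs'', ← map_mul, Valuation.restrict_lt_iff, map_mul, key', key s, key r]
  exact hx

/-- If `|f a|_w = |a|_v` for all `a : L`, the continuous extension `L_v → L_w` of `f`. -/
def finiteMap (f : L ≃+* L) {v w : HeightOneSpectrum R}
    (h : ∀ a, w.valuation L (f a) = v.valuation L a) :
    v.adicCompletion L →+* w.adicCompletion L :=
  ((HeightOneSpectrum.adicCompletion.equiv L w).symm.toRingHom.comp
    (UniformSpace.Completion.mapRingHom _ (continuous_finite f h))).comp
    (HeightOneSpectrum.adicCompletion.equiv L v).toRingHom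

lemma finiteMap_coe (f : L ≃+* L) {v w : HeightOneSpectrum R}
    (h : ∀ a, w.valuation L (f a) = v.valuation L a) (a : L) :
    finiteMap f h (a : v.adicCompletion L) = ((f a : L) : w.adicCompletion L) :=
  HeightOneSpectrum.adicCompletion.ext L w <|
    UniformSpace.Completion.mapRingHom_coe (continuous_finite f h) (WithVal.toVal _ a)

lemma continuous_finiteMap (f : L ≃+* L) {v w : HeightOneSpectrum R}
    (h : ∀ a, w.valuation L (f a) = v.valuation L a) : Continuous (finiteMap f h) :=
  (HeightOneSpectrum.adicCompletion.continuous_ofCompletion L w).comp <|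
    UniformSpace.Completion.continuous_map.comp
      (HeightOneSpectrum.adicCompletion.continuous_toCompletion L v)

lemma finite_induction {v : HeightOneSpectrum R} {P : v.adicCompletion L → Prop}
    (x : v.adicCompletion L) (hP : IsClosed {x | P x}) (h : ∀ a : L, P a) : P x :=
  UniformSpace.Completion.induction_on
    (p := fun y ↦ P (HeightOneSpectrum.adicCompletion.ofCompletion y)) x.toCompletion
    (hP.preimage (HeightOneSpectrum.adicCompletion.continuous_ofCompletion L v))
    fun a ↦ h a.ofVal

lemma finiteMap_id {v : HeightOneSpectrum R} (f : L ≃+* L) (hf : ∀ a, f a = a)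
    (h : ∀ a, v.valuation L (f a) = v.valuation L a) (x : v.adicCompletion L) :
    finiteMap f h x = x := by
  induction x using finite_induction with
  | hP => exact isClosed_eq (continuous_finiteMap f h) continuous_id
  | h a => rw [finiteMap_coe, hf]

lemma finiteMap_comp {u v w : HeightOneSpectrum R} (f g k : L ≃+* L) (hk : ∀ a, k a = f (g a))
    (hf : ∀ a, w.valuation L (f a) = v.valuation L a)
    (hg : ∀ a, v.valuation L (g a) = u.valuation L a)
    (hfg : ∀ a, w.valuation L (k a) = u.valuation L a) (x : u.adicCompletion L) :
    finiteMap k hfg x = finiteMap f hf (finiteMap g hg x) := by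
  induction x using finite_induction with
  | hP => exact isClosed_eq (continuous_finiteMap k hfg) <|
        ((continuous_finiteMap f hf).comp (continuous_finiteMap g hg))
  | h a => rw [finiteMap_coe, finiteMap_coe, finiteMap_coe, hk]

lemma valued_finiteMap (f : L ≃+* L) {v w : HeightOneSpectrum R}
    (h : ∀ a, w.valuation L (f a) = v.valuation L a) (x : v.adicCompletion L) :
    Valued.v (finiteMap f h x) = Valued.v x := by
  by_cases hx : x = 0
  · simp [hx]
  have hy : finiteMap f h x ≠ 0 := by simpa using hx
  obtain ⟨a, ha₁, ha₂⟩ := (HeightOneSpectrum.denseRange_algebraMap L v).mem_nhds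
    (Filter.inter_mem (Valued.locally_const (by simpa using hx))
      ((continuous_finiteMap f h).continuousAt.preimage_mem_nhds
        (Valued.locally_const (by simpa using hy))))
  change Valued.v (a : v.adicCompletion L) = _ at ha₁
  change Valued.v (finiteMap f h (a : v.adicCompletion L)) = _ at ha₂
  rw [← ha₁, ← ha₂, finiteMap_coe, HeightOneSpectrum.adicCompletion.valued_coe,
    HeightOneSpectrum.adicCompletion.valued_coe, h]

end Finite

/-! ### The Galois action on places and on ideles -/

variable {K L : Type*} [Field K] [Field L] [Algebra K L]

lemma comap_apply_infinite (σ : Gal(L/K)) (w : InfinitePlace L) (a : L) :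
    w ((σ : L →+* L) a) = (w.comap (σ : L →+* L)) a := rfl

/-- The automorphism of `𝓞 L` induced by `σ`. -/
def intEquiv (σ : Gal(L/K)) : 𝓞 L ≃+* 𝓞 L := MulSemiringAction.toRingEquiv Gal(L/K) (𝓞 L) σ

lemma coe_intEquiv (σ : Gal(L/K)) (a : 𝓞 L) : (intEquiv σ a : L) = σ a := rfl

/-- The finite place `σ⁻¹ w`, i.e. the prime ideal `σ⁻¹(𝔭_w)`. -/
def comapFinite (σ : Gal(L/K)) (w : HeightOneSpectrum (𝓞 L)) : HeightOneSpectrum (𝓞 L) :=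
  w.comap (intEquiv σ : 𝓞 L →+* 𝓞 L) (intEquiv σ).surjective

lemma comapFinite_injective (σ : Gal(L/K)) :
    Function.Injective (comapFinite σ) :=
  (HeightOneSpectrum.equivOfRingEquiv (intEquiv σ)).symm.injective

/-- The action of the Galois group on the infinite adeles: `(σ x)_w = σ (x_{σ⁻¹ w})`. -/
instance : SMul Gal(L/K) (L∞) where
  smul σ x := fun w ↦ infiniteMap (σ : L →+* L) (comap_apply_infinite σ w)
    (x (w.comap (σ : L →+* L)))

lemma infinite_smul_apply (σ : Gal(L/K)) (x : L∞) (w : InfinitePlace L) :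
    (σ • x) w = infiniteMap (σ : L →+* L) (comap_apply_infinite σ w)
      (x (w.comap (σ : L →+* L))) := rfl

instance : MulSemiringAction Gal(L/K) (L∞) where
  one_smul x := funext fun w ↦ by
    rw [infinite_smul_apply]
    exact infiniteMap_id (v := w) ((1 : Gal(L/K)) : L →+* L) (fun _ ↦ rfl) (fun _ ↦ rfl) (x w)
  mul_smul σ τ x := funext fun w ↦ by
    rw [infinite_smul_apply, infinite_smul_apply, infinite_smul_apply]
    exact infiniteMap_comp (σ : L →+* L) (τ : L →+* L) ((σ * τ : Gal(L/K)) : L →+* L)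
      (fun _ ↦ rfl) (comap_apply_infinite σ w) (comap_apply_infinite τ _)
      (comap_apply_infinite (σ * τ) w) _
  smul_zero σ := funext fun w ↦ by rw [infinite_smul_apply]; exact map_zero _
  smul_one σ := funext fun w ↦ by rw [infinite_smul_apply]; exact map_one _
  smul_add σ x y := funext fun w ↦ by
    rw [infinite_smul_apply]; exact map_add (infiniteMap _ _) _ _
  smul_mul σ x y := funext fun w ↦ by
    rw [infinite_smul_apply]; exact map_mul (infiniteMap _ _) _ _

variable [NumberField L]

lemma intValuation_comapFinite (σ : Gal(L/K)) (w : HeightOneSpectrum (𝓞 L)) (a : 𝓞 L) :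
    w.intValuation (intEquiv σ a) = (comapFinite σ w).intValuation a := by
  have key (n : ℕ) : w.intValuation (intEquiv σ a) ≤ WithZero.exp (-(n : ℤ)) ↔
      (comapFinite σ w).intValuation a ≤ WithZero.exp (-(n : ℤ)) := by
    rw [HeightOneSpectrum.intValuation_le_pow_iff_mem,
      HeightOneSpectrum.intValuation_le_pow_iff_mem]
    change _ ↔ a ∈ (w.asIdeal.comap (intEquiv σ)) ^ n
    rw [← Ideal.map_symm, ← Ideal.map_pow, Ideal.map_symm, Ideal.mem_comap]
  have cases (u : HeightOneSpectrum (𝓞 L)) (b : 𝓞 L) (hb : b ≠ 0) :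
      ∃ n : ℕ, u.intValuation b = WithZero.exp (-(n : ℤ)) :=
    ⟨_, u.intValuation_eq_exp_neg_multiplicity hb⟩
  by_cases ha : a = 0
  · simp [ha]
  obtain ⟨m, hm⟩ := cases w (intEquiv σ a) (by simpa using ha)
  obtain ⟨n, hn⟩ := cases (comapFinite σ w) a ha
  exact le_antisymm (hn ▸ (key n).2 hn.le) (hm ▸ (key m).1 hm.le)

lemma valuation_comapFinite (σ : Gal(L/K)) (w : HeightOneSpectrum (𝓞 L)) (a : L) :
    w.valuation L ((σ : L ≃+* L) a) = (comapFinite σ w).valuation L a := by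
  obtain ⟨x, y, hy, rfl⟩ := IsFractionRing.div_surjective (A := 𝓞 L) a
  have (z : 𝓞 L) : (σ : L ≃+* L) (algebraMap (𝓞 L) L z) = algebraMap (𝓞 L) L (intEquiv σ z) := rfl
  rw [map_div₀, map_div₀, map_div₀, this, this, HeightOneSpectrum.valuation_of_algebraMap,
    HeightOneSpectrum.valuation_of_algebraMap, HeightOneSpectrum.valuation_of_algebraMap,
    HeightOneSpectrum.valuation_of_algebraMap, intValuation_comapFinite, intValuation_comapFinite]

/-- The action of the Galois group on the finite adeles: `(σ x)_w = σ (x_{σ⁻¹ w})`. -/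
instance : SMul Gal(L/K) (FiniteAdeleRing (𝓞 L) L) where
  smul σ x := ⟨fun w ↦ finiteMap (σ : L ≃+* L) (valuation_comapFinite σ w) (x (comapFinite σ w)), by
    have := (comapFinite_injective σ).tendsto_cofinite.eventually x.2
    filter_upwards [this] with w hw
    rw [SetLike.mem_coe, HeightOneSpectrum.mem_adicCompletionIntegers] at hw ⊢
    rw [valued_finiteMap]
    exact hw⟩

lemma finite_smul_apply (σ : Gal(L/K)) (x : FiniteAdeleRing (𝓞 L) L)
    (w : HeightOneSpectrum (𝓞 L)) :
    (σ • x) w = finiteMap (σ : L ≃+* L) (valuation_comapFinite σ w) (x (comapFinite σ w)) := rfl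

instance : MulSemiringAction Gal(L/K) (FiniteAdeleRing (𝓞 L) L) where
  one_smul x := FiniteAdeleRing.ext _ fun w ↦ by
    rw [finite_smul_apply]
    exact finiteMap_id (v := w) ((1 : Gal(L/K)) : L ≃+* L) (fun _ ↦ rfl) (fun _ ↦ rfl) (x w)
  mul_smul σ τ x := FiniteAdeleRing.ext _ fun w ↦ by
    rw [finite_smul_apply, finite_smul_apply, finite_smul_apply]
    exact finiteMap_comp (σ : L ≃+* L) (τ : L ≃+* L) ((σ * τ : Gal(L/K)) : L ≃+* L)
      (fun _ ↦ rfl) (valuation_comapFinite σ w) (valuation_comapFinite τ _)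
      (valuation_comapFinite (σ * τ) w) _
  smul_zero σ := FiniteAdeleRing.ext _ fun w ↦ by rw [finite_smul_apply]; exact map_zero _
  smul_one σ := FiniteAdeleRing.ext _ fun w ↦ by rw [finite_smul_apply]; exact map_one _
  smul_add σ x y := FiniteAdeleRing.ext _ fun w ↦ by
    rw [finite_smul_apply]; exact map_add (finiteMap _ _) _ _
  smul_mul σ x y := FiniteAdeleRing.ext _ fun w ↦ by
    rw [finite_smul_apply]; exact map_mul (finiteMap _ _) _ _

/-- The componentwise action of the Galois group on the adeles of `L`. -/
instance : SMul Gal(L/K) (𝔸[L]) where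
  smul σ x := (σ • x.1, σ • x.2)

lemma adele_smul_fst (σ : Gal(L/K)) (x : 𝔸[L]) : (σ • x).1 = σ • x.1 := rfl

lemma adele_smul_snd (σ : Gal(L/K)) (x : 𝔸[L]) : (σ • x).2 = σ • x.2 := rfl

instance : MulSemiringAction Gal(L/K) (𝔸[L]) where
  one_smul x := Prod.ext (one_smul _ x.1) (one_smul _ x.2)
  mul_smul σ τ x := Prod.ext (mul_smul σ τ x.1) <| by
    simp_rw [adele_smul_snd]; exact mul_smul σ τ x.2
  smul_zero σ := Prod.ext (smul_zero σ) <| by rw [adele_smul_snd]; exact smul_zero σ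
  smul_one σ := Prod.ext (smul_one σ) <| by rw [adele_smul_snd]; exact smul_one σ
  smul_add σ x y := Prod.ext (smul_add σ x.1 y.1) <| by
    rw [adele_smul_snd]; exact smul_add σ x.2 y.2
  smul_mul σ x y := Prod.ext (smul_mul' σ x.1 y.1) <| by
    rw [adele_smul_snd]; exact smul_mul' σ x.2 y.2

/-- The action of the Galois group on the ideles of `L`, i.e. the units of the adele ring. -/
instance : MulDistribMulAction Gal(L/K) (𝔸[L])ˣ := Units.mulDistribMulActionRight

/-- The action of the Galois group on the units of the ring of integers of `L`. -/
instance : MulDistribMulAction Gal(L/K) (𝓞 L)ˣ := Units.mulDistribMulActionRight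

variable (L) in
/-- The group `U_L` of idelic units: the ideles of `L` whose component at every finite place `w`
has `w`-adic valuation zero, i.e. the kernel of the map from ideles to fractional ideals. There is
no condition at the infinite places. -/
def idelicUnits : Subgroup (𝔸[L])ˣ where
  carrier := {x | ∀ w : HeightOneSpectrum (𝓞 L), Valued.v ((x : 𝔸[L]).2 w) = 1}
  one_mem' w := map_one Valued.v
  mul_mem' {x y} hx hy w := by
    have : ((x * y : (𝔸[L])ˣ) : 𝔸[L]).2 w = (x : 𝔸[L]).2 w * (y : 𝔸[L]).2 w := rfl
    rw [this, map_mul, hx w, hy w, one_mul]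
  inv_mem' {x} hx w := by
    have : (x : 𝔸[L]).2 w * ((x⁻¹ : (𝔸[L])ˣ) : 𝔸[L]).2 w = 1 :=
      congrArg (fun z : 𝔸[L] ↦ z.2 w) x.mul_inv
    have h := congrArg Valued.v this
    rwa [map_mul, hx w, one_mul, map_one] at h

lemma smul_mem_idelicUnits (σ : Gal(L/K)) {x : (𝔸[L])ˣ} (hx : x ∈ idelicUnits L) :
    σ • x ∈ idelicUnits L := fun w ↦ by
  rw [Units.coe_smul, adele_smul_snd, finite_smul_apply, valued_finiteMap]
  exact hx _

instance : MulDistribMulAction Gal(L/K) (idelicUnits L) where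
  smul σ x := ⟨σ • (x : (𝔸[L])ˣ), smul_mem_idelicUnits σ x.2⟩
  one_smul x := Subtype.ext (one_smul _ (x : (𝔸[L])ˣ))
  mul_smul σ τ x := Subtype.ext (mul_smul σ τ (x : (𝔸[L])ˣ))
  smul_mul σ x y := Subtype.ext (smul_mul' σ (x : (𝔸[L])ˣ) y)
  smul_one σ := Subtype.ext (smul_one σ)

variable (L) in
/-- The diagonal embedding of `𝓞 Lˣ` in the group of idelic units. -/
def unitsToIdelicUnits : (𝓞 L)ˣ →* idelicUnits L :=
  (Units.map ((algebraMap L (𝔸[L])).comp (algebraMap (𝓞 L) L)).toMonoidHom).codRestrict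
    (idelicUnits L) fun u w ↦ by
      change Valued.v (((u : 𝓞 L) : L) : w.adicCompletion L) = 1
      rw [HeightOneSpectrum.adicCompletion.valued_coe]
      exact (HeightOneSpectrum.valuation_of_algebraMap ..).trans
        (HeightOneSpectrum.intValuation_eq_one_iff.2 fun h ↦
          w.isPrime.ne_top (Ideal.eq_top_of_isUnit_mem _ h u.isUnit))

lemma unitsToIdelicUnits_smul (σ : Gal(L/K)) (u : (𝓞 L)ˣ) :
    unitsToIdelicUnits L (σ • u) = σ • unitsToIdelicUnits L u :=
  Subtype.ext <| Units.ext <| Prod.ext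
    (funext fun w ↦ (infiniteMap_coe (σ : L →+* L) (comap_apply_infinite σ w) _).symm)
    (FiniteAdeleRing.ext _ fun w ↦
      (finiteMap_coe (σ : L ≃+* L) (valuation_comapFinite σ w) _).symm)

/-! ### The map on first cohomology groups -/

section Cohomology

variable (K L : Type) [Field K] [Field L] [Algebra K L] [NumberField L]

/-- The `Gal(L/K)`-module of units of the ring of integers of `L`. -/
abbrev unitsRep : Rep ℤ Gal(L/K) := Rep.ofMulDistribMulAction Gal(L/K) (𝓞 L)ˣ

/-- The `Gal(L/K)`-module of idelic units of `L`. -/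
abbrev idelicUnitsRep : Rep ℤ Gal(L/K) := Rep.ofMulDistribMulAction Gal(L/K) (idelicUnits L)

/-- The diagonal embedding as a morphism of `Gal(L/K)`-modules. -/
def unitsRepHom : unitsRep K L ⟶ idelicUnitsRep K L :=
  Rep.ofHom (LinearMap.intertwiningMap_of_isIntertwiningMap _ _
    (unitsToIdelicUnits L).toAdditive.toIntLinearMap
    fun σ u ↦ congrArg Additive.ofMul (unitsToIdelicUnits_smul σ u.toMul))

/-- The map `H¹(Gal(L/K), 𝓞 Lˣ) → H¹(Gal(L/K), U_L)` induced by the diagonal embedding. -/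
def unitsH1Map :
    groupCohomology.H1 (unitsRep K L) ⟶ groupCohomology.H1 (idelicUnitsRep K L) :=
  groupCohomology.map (MonoidHom.id Gal(L/K)) (unitsRepHom K L) 1

end Cohomology

end IdelicUnits

end

/-!
Write `G = Gal(L/K)`. If `I` is an ideal of `𝓞 K` with `I 𝓞 L = (a)`, then `(a)` is `G`-stable, so
`σ ↦ a / σ a` is a cocycle of units. Changing `I` within its class and changing the generator `a`
multiplies `a` by an element of `Kˣ` and a unit of `L`, so the class of the cocycle depends only on
that of `I` (`H1π_eq_of_mk0_eq`). If the cocycle is a coboundary of units, then `a` is a unit times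
an element of `𝓞 K`, and `I` is principal since extension of ideals is injective
(`mk0_eq_one_of_isMulCoboundary₁`). By Hilbert 90 every cocycle of units is `σ ↦ a / σ a` for some
nonzero `a : 𝓞 L` (`exists_mul_smul_eq_of_isMulCocycle₁`). It remains to see that this cocycle dies
in `H¹(G, U_L)` exactly when `(a)` is extended from `𝓞 K`.

* If `I 𝓞 L = (a)`, choose for every prime `v` of `K` a local generator `b_v ∈ K` of `I`. The
  family `(b_v)_{w ∣ v}`, with `1` at the infinite places, is `G`-invariant, and its quotient by
  `a` is an idelic unit `u` with `σ u / u = a / σ a` (`exists_idelicUnit_smul_eq`).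
* Conversely, if `σ u / u = a / σ a`, then `z = a u` is a `G`-invariant idele with the finite
  valuations of `a`. Let `n` be the order of `G`. Approximating `z` at the primes above `v` by an
  integer `y`, all conjugates of `y` are also close to `z` there, so `Tr(y) / n ∈ K` has the
  valuations of `a` at these primes (`exists_valuation_eq_of_smul_eq`). Hence `(a)` is locally, and
  so globally, extended from `𝓞 K` (`exists_map_eq_span_of_valuation_eq`).
-/

/-! ### Ideals that become principal in an extension -/

section Ideals

variable {A B : Type*} [CommRing A] [IsDedekindDomain A] [CommRing B] [IsDedekindDomain B]
  [Algebra A B]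

/-- If `I` becomes principal with generator `a`, then near the primes above `v` the element `a`
agrees, up to units, with an element of `A`. -/
lemma exists_algebraMap_eq_mul_of_map_eq_span {I : Ideal A} {a : B} (ha : a ≠ 0)
    (h : I.map (algebraMap A B) = Ideal.span {a}) (v : Ideal A) [v.IsPrime] :
    ∃ (b : A) (c : B), algebraMap A B b = a * c ∧
      ∀ w : Ideal B, w.IsPrime → w.comap (algebraMap A B) = v → c ∉ w := by
  have hI : I ≠ ⊥ := by
    rintro rfl
    exact ha (Ideal.span_singleton_eq_bot.1 (by rw [← h, Ideal.map_bot]))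
  -- a local generator of `I` at `v`
  obtain ⟨b, hbI, hbv⟩ : ∃ b ∈ I, b ∉ I * v := by
    by_contra! hcon
    have : I * v = I * ⊤ := by
      rw [Ideal.mul_top]
      exact le_antisymm (Ideal.mul_le_inf.trans inf_le_left) hcon
    exact Ideal.IsPrime.ne_top ‹_› (mul_left_cancel₀ hI this)
  obtain ⟨C, hC⟩ := Ideal.dvd_span_singleton.2 hbI
  have hCv : ¬ C ≤ v := fun hle ↦ hbv <| by
    have : b ∈ I * C := hC ▸ Ideal.mem_span_singleton_self b
    exact Ideal.mul_mono_right hle this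
  have hb : algebraMap A B b ∈ Ideal.span {a} := h ▸ Ideal.mem_map_of_mem _ hbI
  obtain ⟨c, hc⟩ := Ideal.mem_span_singleton.1 hb
  refine ⟨b, c, hc, fun w hw hwv hcw ↦ hCv ?_⟩
  have key : Ideal.span {c} = C.map (algebraMap A B) := by
    refine mul_left_cancel₀ (a := Ideal.span {a}) (by simpa using ha) ?_
    rw [Ideal.span_singleton_mul_span_singleton, ← hc, ← h, ← Ideal.map_mul, ← hC, Ideal.map_span,
      Set.image_singleton]
  rw [← hwv, ← Ideal.map_le_iff_le_comap, ← key]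
  simpa using hcw

variable {K L : Type*} [Field K] [Field L] [Algebra K L] [Algebra A K] [Algebra A L]
  [IsFractionRing A K] [IsScalarTower A K L] [Algebra B L] [IsFractionRing B L]
  [IsScalarTower A B L] [Algebra.IsIntegral A B]

/-- A principal ideal of `B` is extended from `A` as soon as, locally on `A`, its generator has
the valuations of an element of `K`. -/
lemma exists_map_eq_span_of_valuation_eq (hB : ¬ IsField B) {a : B} (ha : a ≠ 0)
    (h : ∀ v : HeightOneSpectrum B, ∃ b : K, ∀ w : HeightOneSpectrum B,
      w.asIdeal.comap (algebraMap A B) = v.asIdeal.comap (algebraMap A B) →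
      w.valuation L (algebraMap K L b) = w.valuation L (algebraMap B L a)) :
    ∃ I : Ideal A, I.map (algebraMap A B) = Ideal.span {a} := by
  refine ⟨(Ideal.span {a}).comap (algebraMap A B), le_antisymm Ideal.map_comap_le ?_⟩
  set J := ((Ideal.span {a}).comap (algebraMap A B)).map (algebraMap A B)
  -- the ideal of those `c` with `a * c ∈ J` is contained in no maximal ideal
  let D : Ideal B := Submodule.comap (LinearMap.mulLeft B a) J
  suffices D = ⊤ by
    have h1 : (1 : B) ∈ D := this ▸ Submodule.mem_top
    have : a * 1 ∈ J := h1
    rw [mul_one] at this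
    simpa [Ideal.span_singleton_le_iff_mem] using this
  by_contra hD
  obtain ⟨m, hm, hDm⟩ := Ideal.exists_le_maximal D hD
  let v : HeightOneSpectrum B := ⟨m, hm.isPrime, Ring.ne_bot_of_isMaximal_of_not_isField hm hB⟩
  obtain ⟨b, hb⟩ := h v
  have ha' : algebraMap B L a ≠ 0 := by simpa using ha
  set t : L := algebraMap K L b / algebraMap B L a
  have hta : t * algebraMap B L a = algebraMap K L b := div_mul_cancel₀ _ ha'
  -- the ideal of denominators of `t` meets the complement of the prime below `m`
  let E : Ideal B :=
    { carrier := {c | ∃ r : B, t * algebraMap B L c = algebraMap B L r}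
      zero_mem' := ⟨0, by simp⟩
      add_mem' := by
        rintro x y ⟨r, hr⟩ ⟨s, hs⟩
        exact ⟨r + s, by rw [map_add, mul_add, hr, hs, map_add]⟩
      smul_mem' := by
        rintro c x ⟨r, hr⟩
        exact ⟨c * r, by rw [smul_eq_mul, map_mul, mul_left_comm, hr, map_mul]⟩ }
  have hE : ¬ E.comap (algebraMap A B) ≤ m.comap (algebraMap A B) := by
    intro hle
    obtain ⟨Q, hQE, hQ, hQm⟩ := Ideal.exists_ideal_over_prime_of_isIntegral _ E hle
    have hQ0 : Q ≠ ⊥ := by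
      rintro rfl
      obtain ⟨r, d, hd, hrd⟩ := IsFractionRing.div_surjective (A := B) t
      have hd0 : algebraMap B L d ≠ 0 := by simpa using nonZeroDivisors.ne_zero hd
      have : d ∈ E := ⟨r, by rw [← hrd, div_mul_cancel₀ _ hd0]⟩
      exact nonZeroDivisors.ne_zero hd (hQE this)
    let w : HeightOneSpectrum B := ⟨Q, hQ, hQ0⟩
    have ht : w.valuation L t ≤ 1 := by
      rw [map_div₀, hb w hQm, div_self]
      simpa using ha
    obtain ⟨r, d, hd⟩ := w.exists_primeCompl_mul_eq_of_integer t ht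
    exact d.2 (hQE ⟨r, hd⟩)
  obtain ⟨c, ⟨r, hr⟩, hcm⟩ := Set.not_subset.1 hE
  have hr' : algebraMap B L (a * r) = algebraMap K L (algebraMap A K c * b) := by
    rw [map_mul, ← hr, map_mul, ← hta, ← IsScalarTower.algebraMap_apply A K L,
      ← IsScalarTower.algebraMap_apply A B L]
    ring
  -- `a * r` lies in `K` and is integral over `A`
  obtain ⟨x, hx⟩ : ∃ x : A, algebraMap A B x = a * r := by
    have h1 : IsIntegral A (algebraMap K L (algebraMap A K c * b)) := by
      rw [← hr']
      exact (Algebra.IsIntegral.isIntegral (a * r)).algebraMap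
    obtain ⟨x, hx⟩ := IsIntegrallyClosed.isIntegral_iff.1
      ((isIntegral_algebraMap_iff (algebraMap K L).injective).1 h1)
    refine ⟨x, IsFractionRing.injective B L ?_⟩
    rw [hr', ← hx, ← IsScalarTower.algebraMap_apply A K L, ← IsScalarTower.algebraMap_apply A B L]
  have hrD : r ∈ D := by
    change a * r ∈ J
    rw [← hx]
    refine Ideal.mem_map_of_mem _ (Ideal.mem_comap.2 ?_)
    rw [hx]
    exact Ideal.mul_mem_right _ _ (Ideal.mem_span_singleton_self a)
  have h1 : v.valuation L t = 1 := by
    rw [map_div₀, hb v rfl, div_self]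
    simpa using ha
  have h2 := congrArg (v.valuation L) hr
  rw [map_mul, h1, one_mul, HeightOneSpectrum.valuation_of_algebraMap,
    HeightOneSpectrum.valuation_of_algebraMap,
    HeightOneSpectrum.intValuation_eq_one_iff.2 hcm] at h2
  exact HeightOneSpectrum.intValuation_eq_one_iff.1 h2.symm (hDm hrD)

end Ideals

/-! ### Simultaneous approximation at finitely many primes -/

section Approximation

variable {B L : Type*} [CommRing B] [IsDedekindDomain B] [Field L] [Algebra B L]
  [IsFractionRing B L]

/-- Every `w`-adic integer is approximated by elements of `B`; the error bound is the valuation of a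
nonzero `t : B`. -/
lemma exists_valued_sub_lt (w : HeightOneSpectrum B) (z : w.adicCompletion L)
    (hz : Valued.v z ≤ 1) {t : B} (ht : t ≠ 0) :
    ∃ y : B, Valued.v (((algebraMap B L y : L) : w.adicCompletion L) - z) <
      w.valuation L (algebraMap B L t) := by
  have ht₁ : w.valuation L (algebraMap B L t) ≤ 1 := w.valuation_le_one t
  have ht₀ : w.valuation L (algebraMap B L t) ≠ 0 := by simpa using ht
  rw [← HeightOneSpectrum.adicCompletion.valued_coe] at ht₀ ht₁ ⊢
  set s : w.adicCompletion L := ((algebraMap B L t : L) : w.adicCompletion L)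
  have hs : Valued.v.restrict s ≠ 0 := fun h ↦ ht₀ <| by
    rw [(map_eq_zero _).1 h, map_zero]
  obtain ⟨n, hn⟩ := (HeightOneSpectrum.denseRange_algebraMap L w).mem_nhds
    (Valued.mem_nhds.2 ⟨Units.mk0 _ hs, subset_rfl⟩ :
      {y | Valued.v.restrict (y - z) < Valued.v.restrict s} ∈ nhds z)
  replace hn : Valued.v ((n : w.adicCompletion L) - z) < Valued.v s :=
    (Valuation.restrict_lt_iff _).1 hn
  have hn₁ : w.valuation L n ≤ 1 := by
    rw [← HeightOneSpectrum.adicCompletion.valued_coe]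
    simpa using Valuation.map_add_le Valued.v (hn.le.trans ht₁) hz
  obtain ⟨y, hy⟩ := w.exists_valuation_sub_lt_of_integer hn₁ (Units.mk0 _ ht₀)
  rw [← HeightOneSpectrum.adicCompletion.valued_coe] at hy
  refine ⟨y, ?_⟩
  have h := Valuation.map_add_lt Valued.v hy hn
  have h2 : ((algebraMap B L y - n : L) : w.adicCompletion L) =
      ((algebraMap B L y : L) : w.adicCompletion L) - (n : w.adicCompletion L) :=
    map_sub (algebraMap L (w.adicCompletion L)) _ _
  rwa [h2, sub_add_sub_cancel] at h

/-- Simultaneous version of `exists_valued_sub_lt`, from the Chinese remainder theorem. -/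
lemma exists_forall_valued_sub_lt (S : Finset (HeightOneSpectrum B))
    (z : ∀ w : HeightOneSpectrum B, w.adicCompletion L) (hz : ∀ w ∈ S, Valued.v (z w) ≤ 1)
    {t : B} (ht : t ≠ 0) :
    ∃ y : B, ∀ w ∈ S,
      Valued.v (((algebraMap B L y : L) : w.adicCompletion L) - z w) <
        w.valuation L (algebraMap B L t) := by
  choose! x hx using fun w hw ↦ exists_valued_sub_lt w (z w) (hz w hw) ht
  have (w : HeightOneSpectrum B) : ∃ n : ℕ,
      WithZero.exp (-(n : ℤ)) < w.valuation L (algebraMap B L t) := by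
    exact WithZero.exists_exp_neg_natCast_lt (by simpa using ht)
  choose n hn using this
  obtain ⟨y, hy⟩ := exists_forall_sub_mem_ideal (s := S) (fun w ↦ w.asIdeal) n
    (fun w _ ↦ w.prime) (fun w _ u _ hne h ↦ hne (HeightOneSpectrum.ext h)) (fun w ↦ x w)
  refine ⟨y, fun w hw ↦ ?_⟩
  have h1 : Valued.v (((algebraMap B L (y - x w) : L) : w.adicCompletion L)) <
      w.valuation L (algebraMap B L t) := by
    rw [HeightOneSpectrum.adicCompletion.valued_coe, HeightOneSpectrum.valuation_of_algebraMap]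
    exact ((w.intValuation_le_pow_iff_mem _ _).2 (hy w hw)).trans_lt (hn w)
  have := Valuation.map_add_lt Valued.v h1 (hx w hw)
  have h2 : ((algebraMap B L (y - x w) : L) : w.adicCompletion L) =
      ((algebraMap B L y : L) : w.adicCompletion L) -
      ((algebraMap B L (x w) : L) : w.adicCompletion L) := by
    rw [map_sub]
    exact map_sub (algebraMap L (w.adicCompletion L)) _ _
  rwa [h2, sub_add_sub_cancel] at this

end Approximation

namespace IdelicUnits

/-! ### Galois-invariant ideles and ideals -/

section Ideles

variable {K L : Type*} [Field K] [Field L] [Algebra K L]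

lemma comap_comapFinite (σ : Gal(L/K)) (w : HeightOneSpectrum (𝓞 L)) :
    (comapFinite σ w).asIdeal.comap (algebraMap (𝓞 K) (𝓞 L)) =
      w.asIdeal.comap (algebraMap (𝓞 K) (𝓞 L)) := by
  ext x
  have : intEquiv σ (algebraMap (𝓞 K) (𝓞 L) x) = algebraMap (𝓞 K) (𝓞 L) x :=
    RingOfIntegers.ext (σ.commutes (x : K))
  change intEquiv σ (algebraMap (𝓞 K) (𝓞 L) x) ∈ w.asIdeal ↔ _
  rw [this]
  rfl

variable [NumberField L]

/-- Idelic units with prescribed components in `L`: one element `c` at all infinite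
places, and elements `x w` of `w`-adic valuation zero at the finite places `w`. -/
lemma exists_idelicUnit {c : L} (hc : c ≠ 0) (x : HeightOneSpectrum (𝓞 L) → L)
    (hx : ∀ w : HeightOneSpectrum (𝓞 L), w.valuation L (x w) = 1) :
    ∃ u : idelicUnits L, (∀ w : InfinitePlace L, ((u : (𝔸[L])ˣ) : 𝔸[L]).1 w = (c : w.Completion)) ∧
      ∀ w : HeightOneSpectrum (𝓞 L),
        ((u : (𝔸[L])ˣ) : 𝔸[L]).2 w = ((x w : L) : w.adicCompletion L) := by
  let fin (y : HeightOneSpectrum (𝓞 L) → L)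
      (hy : ∀ w : HeightOneSpectrum (𝓞 L), w.valuation L (y w) = 1) :
      FiniteAdeleRing (𝓞 L) L :=
    ⟨fun w ↦ ((y w : L) : w.adicCompletion L), .of_forall fun w ↦ by
      rw [SetLike.mem_coe, HeightOneSpectrum.mem_adicCompletionIntegers,
        HeightOneSpectrum.adicCompletion.valued_coe, hy]⟩
  have hx' (w : HeightOneSpectrum (𝓞 L)) : w.valuation L (x w)⁻¹ = 1 := by
    rw [map_inv₀, hx, inv_one]
  have hx₀ (w) : x w ≠ 0 := fun h ↦ by simpa [h] using hx w
  have hmul : ((algebraMap L (L∞) c, fin x hx) : 𝔸[L]) *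
      (algebraMap L (L∞) c⁻¹, fin (fun w ↦ (x w)⁻¹) hx') = 1 := by
    refine Prod.ext ?_ (FiniteAdeleRing.ext _ fun w ↦ ?_)
    · change algebraMap L (L∞) c * algebraMap L (L∞) c⁻¹ = 1
      rw [← map_mul, mul_inv_cancel₀ hc, map_one]
    · change algebraMap L (w.adicCompletion L) (x w) *
        algebraMap L (w.adicCompletion L) (x w)⁻¹ = 1
      rw [← map_mul, mul_inv_cancel₀ (hx₀ w), map_one]
  refine ⟨⟨⟨_, _, hmul, (mul_comm _ _).trans hmul⟩, fun w ↦ ?_⟩, fun w ↦ rfl, fun w ↦ rfl⟩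
  change Valued.v ((x w : L) : w.adicCompletion L) = 1
  rw [HeightOneSpectrum.adicCompletion.valued_coe, hx]

variable [NumberField K]

/-- If `(a)` is extended from an ideal of `K`, the cocycle `σ ↦ a / σ a` is the coboundary of an
idelic unit: `a` times that unit is the Galois-invariant idele given by local generators of the
ideal of `K`. -/
lemma exists_idelicUnit_smul_eq {I : Ideal (𝓞 K)} {a : 𝓞 L} (ha : a ≠ 0)
    (h : I.map (algebraMap (𝓞 K) (𝓞 L)) = Ideal.span {a}) (f : Gal(L/K) → (𝓞 L)ˣ)
    (hf : ∀ σ, (f σ : 𝓞 L) * σ • a = a) :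
    ∃ u : idelicUnits L, ∀ σ : Gal(L/K), σ • u = unitsToIdelicUnits L (f σ) * u := by
  have ha' : (a : L) ≠ 0 := by simpa using ha
  have hf' (σ : Gal(L/K)) : ((f σ : 𝓞 L) : L) * σ (a : L) = a :=
    congrArg (algebraMap (𝓞 L) L) (hf σ)
  have hf₀ {σ : Gal(L/K)} : ((f σ : 𝓞 L) : L) ≠ 0 := by simp
  have hσ₀ (σ : Gal(L/K)) : σ (a : L) ≠ 0 := by simpa using ha
  have local_generator (v : Ideal (𝓞 K)) : ∃ b : 𝓞 K, v.IsPrime → ∀ w : HeightOneSpectrum (𝓞 L),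
      w.asIdeal.comap (algebraMap (𝓞 K) (𝓞 L)) = v →
      w.valuation L (algebraMap K L b) = w.valuation L a := by
    by_cases hv : v.IsPrime
    · obtain ⟨b, c, hbc, hc⟩ := exists_algebraMap_eq_mul_of_map_eq_span ha h v
      refine ⟨b, fun _ w hw ↦ ?_⟩
      have : algebraMap K L b = (a : L) * (c : L) := congrArg (algebraMap (𝓞 L) L) hbc
      rw [this, map_mul, HeightOneSpectrum.valuation_of_algebraMap _ c,
        HeightOneSpectrum.intValuation_eq_one_iff.2 (hc _ w.isPrime hw), mul_one]
    · exact ⟨0, fun h ↦ absurd h hv⟩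
  choose b hb using local_generator
  obtain ⟨u, hu₁, hu₂⟩ := exists_idelicUnit (inv_ne_zero ha')
    (fun w ↦ algebraMap K L (b (w.asIdeal.comap (algebraMap (𝓞 K) (𝓞 L)))) / a) fun w ↦ by
      rw [map_div₀, hb _ inferInstance w rfl, div_self]
      simpa using ha
  refine ⟨u, fun σ ↦ Subtype.ext <| Units.ext <| Prod.ext (funext fun w ↦ ?_)
    (FiniteAdeleRing.ext _ fun w ↦ ?_)⟩
  · change infiniteMap (σ : L →+* L) (comap_apply_infinite σ w) (((u : (𝔸[L])ˣ) : 𝔸[L]).1 _) =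
      algebraMap L w.Completion ((f σ : 𝓞 L) : L) * ((u : (𝔸[L])ˣ) : 𝔸[L]).1 w
    rw [hu₁, hu₁, infiniteMap_coe]
    change algebraMap L w.Completion _ = _ * algebraMap L w.Completion _
    rw [← map_mul]
    refine congrArg (algebraMap L w.Completion) (?_ : σ (a : L)⁻¹ = ((f σ : 𝓞 L) : L) * (a : L)⁻¹)
    rw [map_inv₀, inv_eq_iff_eq_inv, mul_inv, inv_inv, eq_inv_mul_iff_mul_eq₀ hf₀, hf' σ]
  · change finiteMap (σ : L ≃+* L) (valuation_comapFinite σ w) (((u : (𝔸[L])ˣ) : 𝔸[L]).2 _) =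
      algebraMap L (w.adicCompletion L) ((f σ : 𝓞 L) : L) * ((u : (𝔸[L])ˣ) : 𝔸[L]).2 w
    rw [hu₂, hu₂, finiteMap_coe, comap_comapFinite]
    change algebraMap L (w.adicCompletion L) _ = _ * algebraMap L (w.adicCompletion L) _
    rw [← map_mul]
    set β : L := algebraMap K L (b (w.asIdeal.comap (algebraMap (𝓞 K) (𝓞 L))))
    have hσβ : σ β = β := σ.commutes _
    refine congrArg (algebraMap L (w.adicCompletion L))
      (?_ : σ (β / a) = ((f σ : 𝓞 L) : L) * (β / a))
    rw [map_div₀, hσβ, mul_div_assoc', div_eq_div_iff (hσ₀ σ) ha']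
    linear_combination -β * hf' σ

/-- At the places above a given prime of `K`, a Galois-invariant idele with the valuations of
`a : 𝓞 L` has the valuations of an element of `K`: approximate the idele by a global integer `y`
and take the mean of the conjugates of `y`. -/
lemma exists_valuation_eq_of_smul_eq [IsGalois K L] (z : FiniteAdeleRing (𝓞 L) L)
    (hz : ∀ σ : Gal(L/K), σ • z = z) {a : 𝓞 L} (ha : a ≠ 0)
    (hza : ∀ w, Valued.v (z w) = w.valuation L a) (v : HeightOneSpectrum (𝓞 L)) :
    ∃ b : K, ∀ w : HeightOneSpectrum (𝓞 L),
      w.asIdeal.comap (algebraMap (𝓞 K) (𝓞 L)) = v.asIdeal.comap (algebraMap (𝓞 K) (𝓞 L)) →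
      w.valuation L (algebraMap K L b) = w.valuation L a := by
  have hfin : {w : HeightOneSpectrum (𝓞 L) | w.asIdeal.comap (algebraMap (𝓞 K) (𝓞 L)) =
      v.asIdeal.comap (algebraMap (𝓞 K) (𝓞 L))}.Finite := by
    have := Algebra.QuasiFinite.finite_primesOver (S := 𝓞 L)
      (v.asIdeal.comap (algebraMap (𝓞 K) (𝓞 L)))
    refine Set.Finite.of_finite_image (f := HeightOneSpectrum.asIdeal) (this.subset ?_)
      fun w _ u _ h ↦ HeightOneSpectrum.ext h
    rintro _ ⟨w, hw, rfl⟩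
    exact ⟨w.isPrime, ⟨hw.symm⟩⟩
  set N : ℕ := Fintype.card Gal(L/K)
  have hN : (N : 𝓞 L) ≠ 0 := by simp [N, Fintype.card_ne_zero]
  obtain ⟨y, hy⟩ := exists_forall_valued_sub_lt (L := L) hfin.toFinset z
    (fun w _ ↦ (hza w).trans_le (w.valuation_le_one a)) (mul_ne_zero hN ha)
  refine ⟨Algebra.trace K L y / N, fun w hw ↦ ?_⟩
  have hN' : (N : L) ≠ 0 := by exact_mod_cast hN
  -- invariance of `z` makes the valuations of `a` at conjugate places equal
  have val_conj (σ : Gal(L/K)) : (comapFinite σ w).valuation L a = w.valuation L a := by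
    rw [← hza, ← hza, ← valued_finiteMap (σ : L ≃+* L) (valuation_comapFinite σ w),
      ← finite_smul_apply, hz]
  have val_natCast (σ : Gal(L/K)) : (comapFinite σ w).valuation L N = w.valuation L N := by
    rw [← valuation_comapFinite, map_natCast]
  -- `σ y` approximates `z` at `w`, since `y` approximates `z` at `σ⁻¹ w` and `σ z = z`
  have near (σ : Gal(L/K)) : Valued.v (((σ (y : L) : L) : w.adicCompletion L) - z w) <
      w.valuation L (N * a) := by
    have h1 : ((σ (y : L) : L) : w.adicCompletion L) - z w =
        finiteMap (σ : L ≃+* L) (valuation_comapFinite σ w)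
          (((y : L) : (comapFinite σ w).adicCompletion L) - z (comapFinite σ w)) := by
      rw [map_sub, ← finite_smul_apply, hz, finiteMap_coe]
      rfl
    have h2 := hy (comapFinite σ w) (by simpa [comap_comapFinite] using hw)
    rw [h1, valued_finiteMap]
    rw [map_mul, map_natCast, map_mul, val_natCast, val_conj, ← map_mul] at h2
    exact h2
  have hNa : w.valuation L (N * a) ≠ 0 := by
    rw [Valuation.ne_zero_iff]
    exact mul_ne_zero hN' (by simpa using ha)
  have hsum : Valued.v (((∑ σ : Gal(L/K), σ (y : L) : L) : w.adicCompletion L) - N * z w) <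
      w.valuation L (N * a) := by
    have : ((∑ σ : Gal(L/K), σ (y : L) : L) : w.adicCompletion L) - N * z w =
        ∑ σ : Gal(L/K), (((σ (y : L) : L) : w.adicCompletion L) - z w) := by
      rw [Finset.sum_sub_distrib, Finset.sum_const, Finset.card_univ, nsmul_eq_mul]
      exact congrArg (· - _) (map_sum (algebraMap L (w.adicCompletion L)) _ _)
    rw [this]
    exact Valuation.map_sum_lt _ hNa fun σ _ ↦ near σ
  have hNz : Valued.v ((N : w.adicCompletion L) * z w) = w.valuation L (N * a) := by
    have : (N : w.adicCompletion L) = ((N : L) : w.adicCompletion L) :=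
      (map_natCast (algebraMap L (w.adicCompletion L)) N).symm
    rw [map_mul, map_mul, hza, this, HeightOneSpectrum.adicCompletion.valued_coe]
  have key := Valuation.map_eq_of_sub_lt Valued.v (hNz ▸ hsum)
  rw [hNz, HeightOneSpectrum.adicCompletion.valued_coe, ← trace_eq_sum_automorphisms, map_mul]
    at key
  rw [map_div₀, map_div₀, key, map_natCast (algebraMap K L), mul_div_cancel_left₀]
  exact (Valuation.ne_zero_iff _).2 hN'

/-- If the cocycle `σ ↦ a / σ a` is the coboundary of an idelic unit, then `(a)` is extended from
an ideal of `K`. -/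
lemma exists_map_eq_span_of_idelicUnit [IsGalois K L] {a : 𝓞 L} (ha : a ≠ 0)
    (f : Gal(L/K) → (𝓞 L)ˣ) (hf : ∀ σ, (f σ : 𝓞 L) * σ • a = a) (u : idelicUnits L)
    (hu : ∀ σ : Gal(L/K), σ • u = unitsToIdelicUnits L (f σ) * u) :
    ∃ I : Ideal (𝓞 K), I.map (algebraMap (𝓞 K) (𝓞 L)) = Ideal.span {a} := by
  have hf' (σ : Gal(L/K)) : ((f σ : 𝓞 L) : L) * σ (a : L) = a :=
    congrArg (algebraMap (𝓞 L) L) (hf σ)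
  refine exists_map_eq_span_of_valuation_eq (K := K) (L := L) (RingOfIntegers.not_isField L) ha
    (exists_valuation_eq_of_smul_eq
      (algebraMap L (FiniteAdeleRing (𝓞 L) L) a * ((u : (𝔸[L])ˣ) : 𝔸[L]).2) (fun σ ↦ ?_) ha
      fun w ↦ ?_)
  · refine FiniteAdeleRing.ext _ fun w ↦ ?_
    have hu' : finiteMap (σ : L ≃+* L) (valuation_comapFinite σ w)
        (((u : (𝔸[L])ˣ) : 𝔸[L]).2 (comapFinite σ w)) =
        algebraMap L (w.adicCompletion L) ((f σ : 𝓞 L) : L) * ((u : (𝔸[L])ˣ) : 𝔸[L]).2 w :=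
      congrArg (fun x : idelicUnits L ↦ ((x : (𝔸[L])ˣ) : 𝔸[L]).2 w) (hu σ)
    change finiteMap (σ : L ≃+* L) (valuation_comapFinite σ w)
      (((a : L) : (comapFinite σ w).adicCompletion L) * ((u : (𝔸[L])ˣ) : 𝔸[L]).2 _) =
      algebraMap L (w.adicCompletion L) (a : L) * ((u : (𝔸[L])ˣ) : 𝔸[L]).2 w
    rw [map_mul, hu', finiteMap_coe]
    change algebraMap L (w.adicCompletion L) (σ (a : L)) * _ = _
    rw [← mul_assoc, ← map_mul, mul_comm (σ (a : L)), hf' σ]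
  · change Valued.v (((a : L) : w.adicCompletion L) * ((u : (𝔸[L])ˣ) : 𝔸[L]).2 w) = _
    rw [map_mul, u.2 w, mul_one, HeightOneSpectrum.adicCompletion.valued_coe]

end Ideles

end IdelicUnits

/-! ### First cohomology in terms of multiplicative cocycles -/

namespace groupCohomology

variable {G M : Type} [Group G] [CommGroup M] [MulDistribMulAction G M]

lemma H1π_cocyclesOfIsMulCocycle₁_eq_zero_iff {f : G → M} (hf : IsMulCocycle₁ f) :
    H1π (Rep.ofMulDistribMulAction G M) (cocyclesOfIsMulCocycle₁ hf) = 0 ↔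
      IsMulCoboundary₁ f := by
  rw [H1π_eq_zero_iff]
  exact ⟨fun h ↦ isMulCoboundary₁_of_mem_coboundaries₁ f h,
    fun h ↦ (coboundariesOfIsMulCoboundary₁ h).2⟩

lemma H1π_cocyclesOfIsMulCocycle₁_mul {f g : G → M} (hf : IsMulCocycle₁ f)
    (hg : IsMulCocycle₁ g) (hfg : IsMulCocycle₁ (f * g)) :
    H1π (Rep.ofMulDistribMulAction G M) (cocyclesOfIsMulCocycle₁ hfg) =
      H1π (Rep.ofMulDistribMulAction G M) (cocyclesOfIsMulCocycle₁ hf) +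
      H1π (Rep.ofMulDistribMulAction G M) (cocyclesOfIsMulCocycle₁ hg) := by
  rw [← map_add]
  rfl

lemma IsMulCocycle₁.mul {f g : G → M} (hf : IsMulCocycle₁ f) (hg : IsMulCocycle₁ g) :
    IsMulCocycle₁ (f * g) := fun s t ↦ by
  simp only [Pi.mul_apply, hf s t, hg s t, smul_mul']
  exact mul_mul_mul_comm ..

lemma IsMulCoboundary₁.isMulCocycle₁ {f : G → M} (hf : IsMulCoboundary₁ f) :
    IsMulCocycle₁ f := by
  obtain ⟨m, hm⟩ := hf
  intro s t
  rw [← hm, ← hm, ← hm, smul_div', mul_smul, div_mul_div_cancel]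

end groupCohomology

namespace IdelicUnits

open groupCohomology

/-! ### The cocycle of an ideal that becomes principal -/

section Cocycle

variable {K L : Type} [Field K] [Field L] [Algebra K L]

lemma isMulCocycle₁_of_mul_smul_eq {a : 𝓞 L} (ha : a ≠ 0) {f : Gal(L/K) → (𝓞 L)ˣ}
    (hf : ∀ σ, (f σ : 𝓞 L) * σ • a = a) : IsMulCocycle₁ f := fun σ τ ↦ by
  have hne : (σ * τ) • a ≠ 0 := (smul_ne_zero_iff_ne _).2 ha
  refine Units.ext (mul_right_cancel₀ hne ?_)
  rw [hf, Units.val_mul, Units.coe_smul, mul_smul, mul_right_comm, ← smul_mul', hf, mul_comm, hf]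

/-- The quotients `a / σ a` are units when `(a)` is extended from `K`, as `(a)` is then
Galois-stable. -/
lemma exists_mul_smul_eq {I : Ideal (𝓞 K)} {a : 𝓞 L}
    (h : I.map (algebraMap (𝓞 K) (𝓞 L)) = Ideal.span {a}) :
    ∃ f : Gal(L/K) → (𝓞 L)ˣ, ∀ σ, (f σ : 𝓞 L) * σ • a = a := by
  have (σ : Gal(L/K)) : Associated (σ • a) a := by
    have hσ : (intEquiv σ : 𝓞 L →+* 𝓞 L).comp (algebraMap (𝓞 K) (𝓞 L)) = algebraMap (𝓞 K) (𝓞 L) :=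
      RingHom.ext fun x ↦ RingOfIntegers.ext (σ.commutes (x : K))
    have h1 := congrArg (Ideal.map (intEquiv σ : 𝓞 L →+* 𝓞 L)) h
    rw [Ideal.map_map, hσ, h, Ideal.map_span, Set.image_singleton] at h1
    exact Ideal.span_singleton_eq_span_singleton.1 h1.symm
  choose f hf using this
  exact ⟨f, fun σ ↦ by rw [mul_comm, hf]⟩

variable [NumberField K]

/-- The class of `σ ↦ a / σ a` depends only on the ideal class of `I`. -/
lemma H1π_eq_of_mk0_eq {I J : (Ideal (𝓞 K))⁰} {a b : 𝓞 L}
    (hIJ : ClassGroup.mk0 I = ClassGroup.mk0 J) (ha : a ≠ 0) (hb : b ≠ 0)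
    (hI : (I : Ideal (𝓞 K)).map (algebraMap (𝓞 K) (𝓞 L)) = Ideal.span {a})
    (hJ : (J : Ideal (𝓞 K)).map (algebraMap (𝓞 K) (𝓞 L)) = Ideal.span {b})
    {f g : Gal(L/K) → (𝓞 L)ˣ} (hf : ∀ σ, (f σ : 𝓞 L) * σ • a = a)
    (hg : ∀ σ, (g σ : 𝓞 L) * σ • b = b) :
    H1π (unitsRep K L) (cocyclesOfIsMulCocycle₁ (isMulCocycle₁_of_mul_smul_eq ha hf)) =
      H1π (unitsRep K L) (cocyclesOfIsMulCocycle₁ (isMulCocycle₁_of_mul_smul_eq hb hg)) := by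
  obtain ⟨x, y, hx, hy, hxy⟩ := ClassGroup.mk0_eq_mk0_iff.1 hIJ
  have h := congrArg (Ideal.map (algebraMap (𝓞 K) (𝓞 L))) hxy
  rw [Ideal.map_mul, Ideal.map_mul, Ideal.map_span, Ideal.map_span, Set.image_singleton,
    Set.image_singleton, hI, hJ, Ideal.span_singleton_mul_span_singleton,
    Ideal.span_singleton_mul_span_singleton, Ideal.span_singleton_eq_span_singleton] at h
  obtain ⟨ε, hε⟩ := h
  -- `x a ε = y b` with `x`, `y` in `K`, so `f σ / g σ = σ ε / ε`
  have hcob : IsMulCoboundary₁ (fun σ : Gal(L/K) ↦ σ • ε / ε) := ⟨ε, fun _ ↦ rfl⟩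
  have hfg : f = g * fun σ : Gal(L/K) ↦ σ • ε / ε := by
    funext σ
    rw [Pi.mul_apply, mul_div_assoc', eq_div_iff_mul_eq']
    refine Units.ext ?_
    have hσ := congrArg (σ • ·) hε
    have hσx : σ • algebraMap (𝓞 K) (𝓞 L) x = algebraMap (𝓞 K) (𝓞 L) x :=
      RingOfIntegers.ext (σ.commutes (x : K))
    have hσy : σ • algebraMap (𝓞 K) (𝓞 L) y = algebraMap (𝓞 K) (𝓞 L) y :=
      RingOfIntegers.ext (σ.commutes (y : K))
    simp only [smul_mul', hσx, hσy] at hσ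
    have hne : algebraMap (𝓞 K) (𝓞 L) x * σ • a ≠ 0 :=
      mul_ne_zero (by simpa using hx) ((smul_ne_zero_iff_ne _).2 ha)
    refine mul_right_cancel₀ hne ?_
    rw [Units.val_mul, Units.val_mul, Units.coe_smul]
    linear_combination (algebraMap (𝓞 K) (𝓞 L) x) * ε * hf σ - (g σ : 𝓞 L) * hσ -
      algebraMap (𝓞 K) (𝓞 L) y * hg σ + hε
  have := H1π_cocyclesOfIsMulCocycle₁_mul (isMulCocycle₁_of_mul_smul_eq hb hg)
    hcob.isMulCocycle₁ ((isMulCocycle₁_of_mul_smul_eq hb hg).mul hcob.isMulCocycle₁)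
  rw [(H1π_cocyclesOfIsMulCocycle₁_eq_zero_iff hcob.isMulCocycle₁).2 hcob, add_zero] at this
  rw [← this]
  congr 2

variable [NumberField L]

lemma H1π_mem_ker_unitsH1Map_iff {K L : Type} [Field K] [Field L] [Algebra K L] [NumberField L]
    {f : Gal(L/K) → (𝓞 L)ˣ} (hf : IsMulCocycle₁ f) :
    H1π (unitsRep K L) (cocyclesOfIsMulCocycle₁ hf) ∈ LinearMap.ker (unitsH1Map K L).hom ↔
      IsMulCoboundary₁ (fun σ ↦ unitsToIdelicUnits L (f σ)) := by
  have hf' : IsMulCocycle₁ (fun σ ↦ unitsToIdelicUnits L (f σ)) := fun σ τ ↦ by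
    beta_reduce
    rw [hf, map_mul, unitsToIdelicUnits_smul]
  have key : mapCocycles₁ (MonoidHom.id Gal(L/K)) (unitsRepHom K L) (cocyclesOfIsMulCocycle₁ hf) =
      cocyclesOfIsMulCocycle₁ hf' := by
    exact Subtype.ext rfl
  have h := H1π_comp_map_apply (MonoidHom.id Gal(L/K)) (unitsRepHom K L)
    (cocyclesOfIsMulCocycle₁ hf)
  rw [key] at h
  rw [← H1π_cocyclesOfIsMulCocycle₁_eq_zero_iff hf', LinearMap.mem_ker]
  exact ⟨fun h' ↦ h.symm.trans h', fun h' ↦ h.trans h'⟩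

variable (K L) in
lemma map_injective_ringOfIntegers :
    Function.Injective (Ideal.map (algebraMap (𝓞 K) (𝓞 L))) := fun I J h ↦ by
  refine FractionalIdeal.coeIdeal_injective (K := K)
    (FractionalIdeal.extendedHom_injective (𝓞 K) K L (𝓞 L) ?_)
  simp only [FractionalIdeal.extendedHom_coeIdeal_eq_map, h]

/-- By Hilbert 90, every cocycle of units has the form `σ ↦ a / σ a` with `a` integral. -/
lemma exists_mul_smul_eq_of_isMulCocycle₁ {f : Gal(L/K) → (𝓞 L)ˣ} (hf : IsMulCocycle₁ f) :
    ∃ a : 𝓞 L, a ≠ 0 ∧ ∀ σ, (f σ : 𝓞 L) * σ • a = a := by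
  have : FiniteDimensional K L := inferInstance
  obtain ⟨β, hβ⟩ := isMulCoboundary₁_of_isMulCocycle₁_of_aut_to_units (K := K)
    (fun σ ↦ Units.map (algebraMap (𝓞 L) L).toMonoidHom (f σ)) fun σ τ ↦ by
      beta_reduce
      rw [hf, map_mul]
      rfl
  -- clear denominators by a rational integer
  obtain ⟨n, hn, hint⟩ := ((IsFractionRing.isAlgebraic_iff ℤ ℚ L).2
    (Algebra.IsAlgebraic.isAlgebraic ((β⁻¹ : Lˣ) : L))).exists_integral_multiple
  have hβ' (σ : Gal(L/K)) : ((f σ : 𝓞 L) : L) * σ (β⁻¹ : Lˣ) = (β⁻¹ : Lˣ) := by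
    have h : σ • β / β = Units.map (algebraMap (𝓞 L) L).toMonoidHom (f σ) := hβ σ
    rw [div_eq_iff_eq_mul] at h
    have h' : σ (β : L) = ((f σ : 𝓞 L) : L) * β := congrArg Units.val h
    have hne : σ (β : L) ≠ 0 := by simp
    rw [Units.val_inv_eq_inv_val, map_inv₀, mul_inv_eq_iff_eq_mul₀ hne, h', mul_left_comm,
      inv_mul_cancel₀ β.ne_zero, mul_one]
  refine ⟨⟨n • ((β⁻¹ : Lˣ) : L), hint⟩, fun h ↦ ?_, fun σ ↦ RingOfIntegers.ext ?_⟩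
  · have h' : n • ((β⁻¹ : Lˣ) : L) = 0 := congrArg (algebraMap (𝓞 L) L) h
    exact (smul_ne_zero hn (β⁻¹).ne_zero) h'
  · change ((f σ : 𝓞 L) : L) * σ (n • ((β⁻¹ : Lˣ) : L)) = n • ((β⁻¹ : Lˣ) : L)
    rw [map_zsmul, mul_smul_comm, hβ']

variable [IsGalois K L]

/-- If `σ ↦ a / σ a` is a coboundary of units, then `a` is a unit times an element of `K`. -/
lemma mk0_eq_one_of_isMulCoboundary₁ {I : (Ideal (𝓞 K))⁰} {a : 𝓞 L}
    (hI : (I : Ideal (𝓞 K)).map (algebraMap (𝓞 K) (𝓞 L)) = Ideal.span {a})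
    {f : Gal(L/K) → (𝓞 L)ˣ} (hf : ∀ σ, (f σ : 𝓞 L) * σ • a = a) (h : IsMulCoboundary₁ f) :
    ClassGroup.mk0 I = 1 := by
  obtain ⟨ε, hε⟩ := h
  have hinv (σ : Gal(L/K)) : σ • (a * ε) = a * ε := by
    have h1 : σ • (ε : 𝓞 L) = f σ * ε := by
      rw [← Units.val_mul, ← hε, div_mul_cancel, Units.coe_smul]
    rw [smul_mul', h1]
    linear_combination ε * hf σ
  obtain ⟨x, hx⟩ := Algebra.IsInvariant.isInvariant (A := 𝓞 K) (G := Gal(L/K)) _ hinv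
  refine (ClassGroup.mk0_eq_one_iff I.2).2 ⟨x, ?_⟩
  refine map_injective_ringOfIntegers K L ?_
  rw [hI, Ideal.submodule_span_eq, Ideal.map_span, Set.image_singleton, hx,
    Ideal.span_singleton_mul_right_unit ε.isUnit]

end Cocycle

/-! ### The isomorphism -/

section Isomorphism

variable {K L : Type} [Field K] [Field L] [NumberField K] [Algebra K L]

variable (K L) in
/-- `ξ` is the class of the cocycle `σ ↦ a / σ a`, where `a` generates the extension to `L` of an
ideal in the class `c`. -/
def IsCapitulationClass (c : ClassGroup (𝓞 K)) (ξ : H1 (unitsRep K L)) : Prop :=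
  ∃ (I : (Ideal (𝓞 K))⁰) (a : 𝓞 L) (f : Gal(L/K) → (𝓞 L)ˣ) (hf : IsMulCocycle₁ f),
    ClassGroup.mk0 I = c ∧
    (I : Ideal (𝓞 K)).map (algebraMap (𝓞 K) (𝓞 L)) = Ideal.span {a} ∧
    (∀ σ : Gal(L/K), (f σ : 𝓞 L) * σ • a = a) ∧
    ξ = H1π (unitsRep K L) (cocyclesOfIsMulCocycle₁ hf)

lemma IsCapitulationClass.mul {c d : ClassGroup (𝓞 K)} {ξ η : H1 (unitsRep K L)}
    (hξ : IsCapitulationClass K L c ξ) (hη : IsCapitulationClass K L d η) :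
    IsCapitulationClass K L (c * d) (ξ + η) := by
  obtain ⟨I, a, f, hf, rfl, hI, hfa, rfl⟩ := hξ
  obtain ⟨J, b, g, hg, rfl, hJ, hgb, rfl⟩ := hη
  refine ⟨I * J, a * b, f * g, hf.mul hg, map_mul _ _ _, ?_, fun σ ↦ ?_,
    (H1π_cocyclesOfIsMulCocycle₁_mul hf hg _).symm⟩
  · rw [Submonoid.coe_mul, Ideal.map_mul, hI, hJ, Ideal.span_singleton_mul_span_singleton]
  · rw [Pi.mul_apply, Units.val_mul, smul_mul', mul_mul_mul_comm, hfa, hgb]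

variable [NumberField L]

lemma ne_zero_of_map_eq_span {I : (Ideal (𝓞 K))⁰} {a : 𝓞 L}
    (h : (I : Ideal (𝓞 K)).map (algebraMap (𝓞 K) (𝓞 L)) = Ideal.span {a}) : a ≠ 0 := by
  rintro rfl
  refine nonZeroDivisors.coe_ne_zero I (map_injective_ringOfIntegers K L ?_)
  simp [h]

lemma mk0_mem_ker_extendedHom_iff (I : (Ideal (𝓞 K))⁰) :
    ClassGroup.mk0 I ∈ (ClassGroup.extendedHom (𝓞 K) (𝓞 L)).ker ↔
      ∃ a : 𝓞 L, (I : Ideal (𝓞 K)).map (algebraMap (𝓞 K) (𝓞 L)) = Ideal.span {a} := by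
  rw [MonoidHom.mem_ker, ClassGroup.extendedHom_mk0]
  exact (ClassGroup.mk0_eq_one_iff _).trans ⟨fun ⟨a, ha⟩ ↦ ⟨a, ha⟩, fun ⟨a, ha⟩ ↦ ⟨a, ha⟩⟩

lemma exists_isCapitulationClass {c : ClassGroup (𝓞 K)}
    (hc : c ∈ (ClassGroup.extendedHom (𝓞 K) (𝓞 L)).ker) : ∃ ξ, IsCapitulationClass K L c ξ := by
  obtain ⟨I, rfl⟩ := ClassGroup.mk0_surjective c
  obtain ⟨a, ha⟩ := (mk0_mem_ker_extendedHom_iff I).1 hc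
  obtain ⟨f, hf⟩ := exists_mul_smul_eq (K := K) (L := L) ha
  exact ⟨_, I, a, f, isMulCocycle₁_of_mul_smul_eq (ne_zero_of_map_eq_span ha) hf, rfl, ha, hf, rfl⟩

lemma IsCapitulationClass.unique {c : ClassGroup (𝓞 K)} {ξ η : H1 (unitsRep K L)}
    (hξ : IsCapitulationClass K L c ξ) (hη : IsCapitulationClass K L c η) : ξ = η := by
  obtain ⟨I, a, f, hf, rfl, hI, hfa, rfl⟩ := hξ
  obtain ⟨J, b, g, hg, hIJ, hJ, hgb, rfl⟩ := hη
  exact H1π_eq_of_mk0_eq hIJ.symm (ne_zero_of_map_eq_span hI) (ne_zero_of_map_eq_span hJ) hI hJ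
    hfa hgb

lemma IsCapitulationClass.mem_ker {c : ClassGroup (𝓞 K)} {ξ : H1 (unitsRep K L)}
    (h : IsCapitulationClass K L c ξ) : ξ ∈ LinearMap.ker (unitsH1Map K L).hom := by
  obtain ⟨I, a, f, hf, rfl, hI, hfa, rfl⟩ := h
  obtain ⟨u, hu⟩ := exists_idelicUnit_smul_eq (ne_zero_of_map_eq_span hI) hI f hfa
  exact (H1π_mem_ker_unitsH1Map_iff hf).2 ⟨u, fun σ ↦ by rw [hu, mul_div_cancel_right]⟩

variable [IsGalois K L]

lemma IsCapitulationClass.eq_one {c : ClassGroup (𝓞 K)} (h : IsCapitulationClass K L c 0) :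
    c = 1 := by
  obtain ⟨I, a, f, hf, rfl, hI, hfa, h0⟩ := h
  exact mk0_eq_one_of_isMulCoboundary₁ hI hfa
    ((H1π_cocyclesOfIsMulCocycle₁_eq_zero_iff hf).1 h0.symm)

lemma exists_isCapitulationClass_of_mem_ker {ξ : H1 (unitsRep K L)}
    (hξ : ξ ∈ LinearMap.ker (unitsH1Map K L).hom) :
    ∃ c ∈ (ClassGroup.extendedHom (𝓞 K) (𝓞 L)).ker, IsCapitulationClass K L c ξ := by
  induction ξ using H1_induction_on with | h x =>
  set f : Gal(L/K) → (𝓞 L)ˣ := Additive.toMul ∘ x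
  have hf : IsMulCocycle₁ f := isMulCocycle₁_of_mem_cocycles₁ _ x.2
  obtain ⟨a, ha, hfa⟩ := exists_mul_smul_eq_of_isMulCocycle₁ hf
  obtain ⟨u, hu⟩ := (H1π_mem_ker_unitsH1Map_iff hf).1 hξ
  obtain ⟨I, hI⟩ := exists_map_eq_span_of_idelicUnit ha f hfa u
    fun σ ↦ div_eq_iff_eq_mul.1 (hu σ)
  have hI0 : I ≠ 0 := by
    rintro rfl
    exact ha (Ideal.span_singleton_eq_bot.1 (hI.symm.trans Ideal.map_bot))
  let I' : (Ideal (𝓞 K))⁰ := ⟨I, mem_nonZeroDivisors_of_ne_zero hI0⟩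
  exact ⟨ClassGroup.mk0 I', (mk0_mem_ker_extendedHom_iff I').2 ⟨a, hI⟩, I', a, f, hf, rfl, hI,
    hfa, rfl⟩

end Isomorphism

end IdelicUnits

theorem proposition4p4 (K L : Type) [Field K] [Field L] [NumberField K] [NumberField L]
    [Algebra K L] [IsGalois K L] (p : ℕ) (hp : p.Prime) (hdeg : Module.finrank K L = p) :
    ∃ e : Additive (ClassGroup.extendedHom (𝓞 K) (𝓞 L)).ker ≃+
        LinearMap.ker (IdelicUnits.unitsH1Map K L).hom,
      ∀ (c : (ClassGroup.extendedHom (𝓞 K) (𝓞 L)).ker) (I : (Ideal (𝓞 K))⁰) (a : 𝓞 L),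
        ClassGroup.mk0 I = (c : ClassGroup (𝓞 K)) →
        (I : Ideal (𝓞 K)).map (algebraMap (𝓞 K) (𝓞 L)) = Ideal.span {a} →
        ∃ (f : Gal(L/K) → (𝓞 L)ˣ) (hf : groupCohomology.IsMulCocycle₁ f),
          (∀ σ : Gal(L/K), (f σ : 𝓞 L) * σ • a = a) ∧
          (e (Additive.ofMul c) : groupCohomology.H1 (IdelicUnits.unitsRep K L)) =
            groupCohomology.H1π (IdelicUnits.unitsRep K L)
              (groupCohomology.cocyclesOfIsMulCocycle₁ hf) := by
  choose φ hφ using fun c : (ClassGroup.extendedHom (𝓞 K) (𝓞 L)).ker ↦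
    IdelicUnits.exists_isCapitulationClass c.2
  let Φ : Additive (ClassGroup.extendedHom (𝓞 K) (𝓞 L)).ker →+
      LinearMap.ker (IdelicUnits.unitsH1Map K L).hom :=
    AddMonoidHom.mk' (fun c ↦ ⟨φ c.toMul, (hφ c.toMul).mem_ker⟩) fun c d ↦
      Subtype.ext ((hφ _).unique ((hφ c.toMul).mul (hφ d.toMul)))
  have hinj : Function.Injective Φ := (injective_iff_map_eq_zero Φ).2 fun c hc ↦ by
    have h0 : φ c.toMul = 0 := congrArg Subtype.val hc
    have h := hφ c.toMul
    rw [h0] at h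
    exact congrArg Additive.ofMul (Subtype.ext h.eq_one)
  have hsurj : Function.Surjective Φ := fun ⟨ξ, hξ⟩ ↦ by
    obtain ⟨c, hc, h⟩ := IdelicUnits.exists_isCapitulationClass_of_mem_ker hξ
    exact ⟨Additive.ofMul ⟨c, hc⟩, Subtype.ext ((hφ ⟨c, hc⟩).unique h)⟩
  refine ⟨AddEquiv.ofBijective Φ ⟨hinj, hsurj⟩, fun c I a hI hIa ↦ ?_⟩
  obtain ⟨f, hf⟩ := IdelicUnits.exists_mul_smul_eq (K := K) (L := L) hIa
  have hcoc := IdelicUnits.isMulCocycle₁_of_mul_smul_eq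
    (IdelicUnits.ne_zero_of_map_eq_span hIa) hf
  exact ⟨f, hcoc, hf, (hφ c).unique ⟨I, a, f, hcoc, hI, hIa, hf, rfl⟩⟩
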